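/- Let $\mathcal{C}$ be the set of all qubit channels, i.e. completely positive trace-preserving linear maps $\Psi$ on the $2\times 2$ complex matrices, and let $J_\Psi=(\mathrm{id}\otimes\Psi)\bigl(\sum_{i,j=0}^{1}|i\rangle\langle j|\otimes|i\rangle\langle j|\bigr)$ be the Choi operator of $\Psi$. Let $\tau$ be a density operator on $\mathbb{C}^2\otimes\mathbb{C}^2$ (positive semidefinite with trace one). Then the maximum $$C(\tau,\mathcal{C})=\max_{\Psi\in\mathcal{C}}\operatorname{tr}[\tau J_\Psi]$$ exists, and $$C(\tau,\mathcal{C})\le\frac12\left(1+\sqrt{\|\boldsymbol b(\tau_2)\|^2+\|N(\tau)\|_{KF}^2}\right).$$ Here $\tau_2=\operatorname{tr}_1\tau$ is the partial trace of $\tau$ over the first factor; $\boldsymbol b(\tau_2)\in\mathbb{R}^3$ is the Bloch vector, with entries $b(\tau_2)_i=\operatorname{tr}[\sigma_i\tau_2]$ for the Pauli matrices $\sigma_1,\sigma_2,\sigma_3$, and $\|\boldsymbol b(\tau_2)\|$ is its Euclidean norm; $N(\tau)$ is the real $3\times3$ correlation matrix with entries $N(\tau)_{ij}=\operatorname{tr}[\tau(\sigma_i\otimes\sigma_j)]$;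 and $\|X\|_{KF}=\operatorname{tr}\sqrt{XX^{T}}$ is the trace norm (the sum of the singular values). -/

import Mathlib

noncomputable section

namespace QubitChannel

open Matrix
open scoped Kronecker ComplexOrder MatrixOrder

/-- Linear operators on a qubit. -/
abbrev Op : Type := Matrix (Fin 2) (Fin 2) ℂ

/-- Linear operators on a pair of qubits; the first index of a pair belongs to the first
tensor factor. -/
abbrev Op₂ : Type := Matrix (Fin 2 × Fin 2) (Fin 2 × Fin 2) ℂ

/-- The Pauli matrices `σ₁, σ₂, σ₃`, indexed from `0`. -/
def pauli : Fin 3 → Op :=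
  ![!![0, 1; 1, 0], !![0, -Complex.I; Complex.I, 0], !![1, 0; 0, -1]]

/-- Density operators: positive semidefinite with trace one. -/
def IsDensity {n : Type*} [Fintype n] (ρ : Matrix n n ℂ) : Prop :=
  ρ.PosSemidef ∧ ρ.trace = 1

/-- The map `id ⊗ Ψ` on operators on `ℂ^k ⊗ ℂ²`: it applies `Ψ` to each `2 × 2` block
`X_{aa'}` in the decomposition `X = ∑ a a', |a⟩⟨a'| ⊗ X_{aa'}`. -/
def idTensor {k : Type*} (Ψ : Op →ₗ[ℂ] Op) (X : Matrix (k × Fin 2) (k × Fin 2) ℂ) :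
    Matrix (k × Fin 2) (k × Fin 2) ℂ :=
  Matrix.of fun p q => Ψ (Matrix.of fun b b' => X (p.1, b) (q.1, b')) p.2 q.2

theorem idTensor_kronecker {k : Type*} (Ψ : Op →ₗ[ℂ] Op) (A : Matrix k k ℂ) (B : Op) :
    idTensor Ψ (A ⊗ₖ B) = A ⊗ₖ Ψ B := by
  ext p q
  have h : (Matrix.of fun b b' => (A ⊗ₖ B) (p.1, b) (q.1, b')) = A p.1 q.1 • B := by
    ext b b'
    simp [Matrix.kroneckerMap_apply]
  change Ψ (Matrix.of fun b b' => (A ⊗ₖ B) (p.1, b) (q.1, b')) p.2 q.2 = A p.1 q.1 * Ψ B p.2 q.2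
  rw [h, map_smul, Matrix.smul_apply, smul_eq_mul]

/-- Complete positivity: `id ⊗ Ψ` preserves positive semidefiniteness for every
finite-dimensional ancilla `ℂ^k`. -/
def IsCompletelyPositive (Ψ : Op →ₗ[ℂ] Op) : Prop :=
  ∀ (k : ℕ) (X : Matrix (Fin k × Fin 2) (Fin k × Fin 2) ℂ),
    X.PosSemidef → (idTensor Ψ X).PosSemidef

def IsTracePreserving (Ψ : Op →ₗ[ℂ] Op) : Prop :=
  ∀ A : Op, (Ψ A).trace = A.trace

/-- The set `𝒞` of all qubit channels. -/
def channels : Set (Op →ₗ[ℂ] Op) :=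
  {Ψ | IsCompletelyPositive Ψ ∧ IsTracePreserving Ψ}

/-- The unnormalized maximally entangled state `∑ i j, |i⟩⟨j| ⊗ |i⟩⟨j|`. -/
def maxEntangled : Op₂ :=
  ∑ i : Fin 2, ∑ j : Fin 2, Matrix.single i j (1 : ℂ) ⊗ₖ Matrix.single i j (1 : ℂ)

/-- The Choi operator `J_Ψ = (id ⊗ Ψ)(∑ i j, |i⟩⟨j| ⊗ |i⟩⟨j|)`. -/
def choi (Ψ : Op →ₗ[ℂ] Op) : Op₂ := idTensor Ψ maxEntangled

/-- The set of all values `tr[τ J_Ψ]` with `Ψ` in the class `𝒳` (these traces are real numbers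
when `τ` is self-adjoint and `Ψ` is completely positive). -/
def choiValues (τ : Op₂) (𝒳 : Set (Op →ₗ[ℂ] Op)) : Set ℝ :=
  (fun Ψ => (τ * choi Ψ).trace.re) '' 𝒳

/-- `C(τ, 𝒳)`, the maximum of `tr[τ J_Ψ]` over `Ψ ∈ 𝒳`, written as a supremum. -/
def maxValue (τ : Op₂) (𝒳 : Set (Op →ₗ[ℂ] Op)) : ℝ := sSup (choiValues τ 𝒳)

/-- The partial trace over the first factor, `τ₂ = tr₁ τ`. -/
def marginal₂ (τ : Op₂) : Op :=
  Matrix.of fun b b' => ∑ a : Fin 2, τ (a, b) (a, b')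

/-- The Bloch vector `b(ρ)_i = tr[σ_i ρ]` (real for self-adjoint `ρ`). -/
def bloch (ρ : Op) : EuclideanSpace ℝ (Fin 3) :=
  WithLp.toLp 2 fun i => (pauli i * ρ).trace.re

/-- The correlation matrix `N(τ)_{ij} = tr[τ (σ_i ⊗ σ_j)]` (real for self-adjoint `τ`). -/
def corrMatrix (τ : Op₂) : Matrix (Fin 3) (Fin 3) ℝ :=
  Matrix.of fun i j => (τ * (pauli i ⊗ₖ pauli j)).trace.re

/-- The Ky Fan (trace) norm `tr √(X Xᵀ)` of a real matrix. -/
def kyFanNorm (X : Matrix (Fin 3) (Fin 3) ℝ) : ℝ := (CFC.sqrt (X * Xᵀ)).trace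

end QubitChannel

end

noncomputable section

namespace QubitChannel

open Matrix
open scoped Kronecker ComplexOrder MatrixOrder

/-! On the Bloch ball a channel acts affinely, r ↦ t + rM (up to a reflection from transposing the
Paulis). Expanding the Choi operator in Paulis gives tr[τJ] = (1 + ⟨t, b⟩ + ⟨M, N⟩)/2
(`trace_mul_choi`). Pure states go to states, so |t ± rM| ≤ 1 for unit r, and the parallelogram law
gives |t|² + |rM|² ≤ 1 (`norm_shift_sq_add_le`). Thus M has operator norm at most √(1 - |t|²), norm
duality bounds ⟨M, N⟩ by √(1 - |t|²)‖N‖_KF, and Cauchy–Schwarz in the plane removes t. The maximum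
exists because the Choi operators of channels form a compact set. -/

/-- Duality between the operator norm and the trace norm of real matrices. -/
theorem sum_mul_le_mul_trace_sqrt {n : Type*} [Fintype n] [DecidableEq n]
    (M N : Matrix n n ℝ) {c : ℝ}
    (hM : ∀ u : n → ℝ, u ⬝ᵥ u = 1 → (u ᵥ* M) ⬝ᵥ (u ᵥ* M) ≤ c ^ 2) (hc : 0 ≤ c) :
    ∑ i, ∑ j, M i j * N i j ≤ c * (CFC.sqrt (N * Nᵀ)).trace := by
  have hN : (N * Nᵀ).PosSemidef := by
    simpa [conjTranspose_eq_transpose_of_trivial] using posSemidef_self_mul_conjTranspose N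
  have hsq : CFC.sqrt (N * Nᵀ) * CFC.sqrt (N * Nᵀ) = N * Nᵀ :=
    CFC.sqrt_mul_sqrt_self _ hN.nonneg
  have hP : (CFC.sqrt (N * Nᵀ)).PosSemidef := (CFC.sqrt_nonneg (N * Nᵀ)).posSemidef
  generalize CFC.sqrt (N * Nᵀ) = P at hsq hP ⊢
  -- The eigenvectors of P are left singular vectors of N: each row vector u i · N has length the
  -- eigenvalue of P at i.
  set u : n → n → ℝ := fun i => ⇑(hP.1.eigenvectorBasis i) with hu
  have horth (i : n) : u i ⬝ᵥ u i = 1 := by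
    have h := (orthonormal_iff_ite.mp hP.1.eigenvectorBasis.orthonormal) i i
    rwa [EuclideanSpace.inner_eq_star_dotProduct, star_trivial, if_pos rfl] at h
  set U : Matrix n n ℝ := of u with hU
  have hUU : Uᵀ * U = 1 := by
    rw [mul_eq_one_comm]
    ext i j
    have h := (orthonormal_iff_ite.mp hP.1.eigenvectorBasis.orthonormal) j i
    rw [EuclideanSpace.inner_eq_star_dotProduct, star_trivial] at h
    simpa [mul_apply, dotProduct, one_apply, eq_comm, hU, hu] using h
  have hvec (i : n) : u i ᵥ* P = hP.1.eigenvalues i • u i := by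
    have h := hP.1.mulVec_eigenvectorBasis i
    have hT : Pᵀ = P := by simpa [conjTranspose_eq_transpose_of_trivial] using hP.1.eq
    have h' := vecMul_transpose P (u i)
    rw [hT] at h'
    exact h'.trans h
  have hnorm (i : n) : (u i ᵥ* N) ⬝ᵥ (u i ᵥ* N) = hP.1.eigenvalues i ^ 2 := by
    have h : (u i ᵥ* N) ⬝ᵥ (u i ᵥ* N) = (u i ᵥ* (N * Nᵀ)) ⬝ᵥ u i := by
      rw [← vecMul_vecMul, vecMul_transpose, dotProduct_comm (N *ᵥ _), dotProduct_mulVec]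
    rw [h, ← hsq, ← vecMul_vecMul, hvec, smul_vecMul, hvec, smul_smul, smul_dotProduct, horth]
    simp [sq]
  have hsum : ∑ i, ∑ j, M i j * N i j = ∑ i, (u i ᵥ* M) ⬝ᵥ (u i ᵥ* N) := by
    have h1 : ∑ i, ∑ j, M i j * N i j = (M * Nᵀ).trace := by
      simp [trace, mul_apply]
    have h2 : ∑ i, (u i ᵥ* M) ⬝ᵥ (u i ᵥ* N) = ((U * M) * (U * N)ᵀ).trace := by
      simp [trace, mul_apply, hU, dotProduct, vecMul, mul_comm]
    rw [h1, h2, transpose_mul, trace_mul_comm (U * M), ← Matrix.mul_assoc, Matrix.mul_assoc Nᵀ,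
      hUU, Matrix.mul_one, trace_mul_comm]
  rw [hsum, hP.1.trace_eq_sum_eigenvalues, Finset.mul_sum]
  refine Finset.sum_le_sum fun i _ => ?_
  have hs : 0 ≤ hP.1.eigenvalues i := hP.eigenvalues_nonneg i
  refine le_of_sq_le_sq ?_ (mul_nonneg hc hs)
  calc ((u i ᵥ* M) ⬝ᵥ (u i ᵥ* N)) ^ 2
      ≤ ((u i ᵥ* M) ⬝ᵥ (u i ᵥ* M)) * ((u i ᵥ* N) ⬝ᵥ (u i ᵥ* N)) := by
        simpa [dotProduct, sq] using
          Finset.sum_mul_sq_le_sq_mul_sq Finset.univ (u i ᵥ* M) (u i ᵥ* N)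
    _ ≤ c ^ 2 * hP.1.eigenvalues i ^ 2 := by
        rw [hnorm]; exact mul_le_mul_of_nonneg_right (hM _ (horth i)) (sq_nonneg _)
    _ = (c * hP.1.eigenvalues i) ^ 2 := by ring

theorem PosSemidef.normSq_apply_le {n : Type*} {A : Matrix n n ℂ}
    (hA : A.PosSemidef) (p q : n) : ‖A p q‖ ^ 2 ≤ (A p p).re * (A q q).re := by
  have h := (hA.submatrix ![p, q]).det_nonneg
  have hp : (A p p).im = 0 := by simpa using (Complex.le_def.mp (hA.diag_nonneg (i := p))).2.symm
  have hpq : A q p = star (A p q) := (hA.1.apply q p).symm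
  rw [det_fin_two] at h
  have h' := (Complex.le_def.mp h).1
  simp only [submatrix_apply, cons_val_zero, cons_val_one, hpq, Complex.sub_re, Complex.mul_re,
    Complex.zero_re, hp, Complex.star_def, Complex.conj_re, Complex.conj_im] at h'
  rw [← Complex.normSq_eq_norm_sq, Complex.normSq_apply]
  linarith

/-! ### Compactness of the set of Choi operators -/

theorem isClosed_posSemidef {n : Type*} [Fintype n] :
    IsClosed {A : Matrix n n ℂ | A.PosSemidef} := by
  have h : {A : Matrix n n ℂ | A.PosSemidef} =
      {A | Aᴴ = A} ∩ ⋂ x : n → ℂ, {A | 0 ≤ star x ⬝ᵥ (A *ᵥ x)} := by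
    ext A
    simp [posSemidef_iff_dotProduct_mulVec, Matrix.IsHermitian]
  rw [h]
  refine (isClosed_eq (by fun_prop) (by fun_prop)).inter (isClosed_iInter fun x => ?_)
  exact isClosed_le continuous_const (by fun_prop)

/-- The linear map with a given Choi operator. -/
def ofChoi (J : Op₂) : Op →ₗ[ℂ] Op where
  toFun A := of fun b b' => ∑ a : Fin 2, ∑ a' : Fin 2, A a a' * J (a, b) (a', b')
  map_add' A B := by
    ext b b'
    simp [add_mul, Finset.sum_add_distrib]
  map_smul' c A := by
    ext b b'
    simp [mul_add, mul_assoc]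

theorem choi_apply (Ψ : Op →ₗ[ℂ] Op) (p q : Fin 2 × Fin 2) :
    choi Ψ p q = Ψ (single p.1 q.1 1) p.2 q.2 := by
  have h : (of fun b b' => maxEntangled (p.1, b) (q.1, b')) = single p.1 q.1 (1 : ℂ) := by
    ext b b'
    obtain ⟨a, -⟩ := p
    obtain ⟨a', -⟩ := q
    fin_cases a <;> fin_cases a' <;> fin_cases b <;> fin_cases b' <;>
      simp [maxEntangled, single_apply, Matrix.add_apply, kroneckerMap_apply]
  change Ψ (of fun b b' => maxEntangled (p.1, b) (q.1, b')) p.2 q.2 = _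
  rw [h]

theorem apply_eq_sum_choi (Ψ : Op →ₗ[ℂ] Op) (A : Op) (b b' : Fin 2) :
    Ψ A b b' = ∑ a : Fin 2, ∑ a' : Fin 2, A a a' * choi Ψ (a, b) (a', b') := by
  conv_lhs => rw [matrix_eq_sum_single A]
  simp only [map_sum, Matrix.sum_apply, choi_apply]
  refine Finset.sum_congr rfl fun a _ => Finset.sum_congr rfl fun a' _ => ?_
  have h : single a a' (A a a') = A a a' • single a a' (1 : ℂ) := by simp
  rw [h, map_smul, Matrix.smul_apply, smul_eq_mul]

theorem ofChoi_choi (Ψ : Op →ₗ[ℂ] Op) : ofChoi (choi Ψ) = Ψ := by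
  refine LinearMap.ext fun A => ?_
  ext b b'
  exact (apply_eq_sum_choi Ψ A b b').symm

theorem choi_ofChoi (J : Op₂) : choi (ofChoi J) = J := by
  ext ⟨a, b⟩ ⟨a', b'⟩
  fin_cases a <;> fin_cases a' <;> simp [choi_apply, ofChoi]

theorem image_choi_channels : choi '' channels = {J | ofChoi J ∈ channels} := by
  ext J
  constructor
  · rintro ⟨Ψ, hΨ, rfl⟩
    simpa [ofChoi_choi] using hΨ
  · exact fun h => ⟨_, h, choi_ofChoi J⟩

@[fun_prop]
theorem continuous_ofChoi_apply (A : Op) : Continuous fun J : Op₂ => ofChoi J A := by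
  simp only [ofChoi, LinearMap.coe_mk, AddHom.coe_mk]
  fun_prop

/-- Through `ofChoi`, each instance of positivity or trace preservation is a closed condition on J.
-/
theorem isClosed_image_choi_channels : IsClosed (choi '' channels) := by
  have h : choi '' channels =
      (⋂ (k : ℕ) (X : Matrix (Fin k × Fin 2) (Fin k × Fin 2) ℂ) (_ : X.PosSemidef),
        {J | (idTensor (ofChoi J) X).PosSemidef}) ∩
      ⋂ A : Op, {J | (ofChoi J A).trace = A.trace} := by
    rw [image_choi_channels]
    ext J
    simp [channels, IsCompletelyPositive, IsTracePreserving]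
  rw [h]
  refine IsClosed.inter (isClosed_iInter fun k => isClosed_iInter fun X => isClosed_iInter
    fun _ => isClosed_posSemidef.preimage ?_)
    (isClosed_iInter fun A => isClosed_eq (by fun_prop) (by fun_prop))
  refine continuous_matrix fun p q => ?_
  exact (continuous_ofChoi_apply _).matrix_elem p.2 q.2

theorem maxEntangled_eq :
    maxEntangled = vecMulVec (fun p : Fin 2 × Fin 2 => if p.1 = p.2 then (1 : ℂ) else 0)
      (star fun p : Fin 2 × Fin 2 => if p.1 = p.2 then (1 : ℂ) else 0) := by
  ext ⟨a, b⟩ ⟨a', b'⟩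
  fin_cases a <;> fin_cases a' <;> fin_cases b <;> fin_cases b' <;>
    simp [maxEntangled, Matrix.add_apply, kroneckerMap_apply, vecMulVec_apply]

theorem posSemidef_choi {Ψ : Op →ₗ[ℂ] Op} (hΨ : IsCompletelyPositive Ψ) :
    (choi Ψ).PosSemidef := by
  refine hΨ 2 _ ?_
  rw [maxEntangled_eq]
  exact posSemidef_vecMulVec_self_star _

/-- Trace preservation puts the diagonal entries in [0, 1]; the 2 × 2 minors then bound all the
others by 1. -/
theorem isCompact_image_choi_channels : IsCompact (choi '' channels) := by
  refine IsCompact.of_isClosed_subset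
    (isCompact_univ_pi fun _ : Fin 2 × Fin 2 => isCompact_univ_pi fun _ : Fin 2 × Fin 2 =>
      isCompact_closedBall (0 : ℂ) 1) isClosed_image_choi_channels ?_
  rintro _ ⟨Ψ, ⟨hcp, htp⟩, rfl⟩ p - q -
  have hJ := posSemidef_choi hcp
  have hdiag (p : Fin 2 × Fin 2) : 0 ≤ (choi Ψ p p).re ∧ (choi Ψ p p).re ≤ 1 := by
    have hnn (p) : 0 ≤ (choi Ψ p p).re := (Complex.le_def.mp (hJ.diag_nonneg (i := p))).1
    refine ⟨hnn p, ?_⟩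
    obtain ⟨a, b⟩ := p
    have ht := congrArg Complex.re (htp (single a a 1))
    rw [trace_single_eq_same, trace_fin_two, Complex.add_re, Complex.one_re] at ht
    have h0 := hnn (a, 0)
    have h1 := hnn (a, 1)
    rw [choi_apply] at h0 h1 ⊢
    fin_cases b <;> simp at h0 h1 ⊢ <;> linarith
  have h := PosSemidef.normSq_apply_le hJ p q
  rw [mem_closedBall_zero_iff, ← sq_le_one_iff₀ (norm_nonneg _)]
  exact h.trans (mul_le_one₀ (hdiag p).2 (hdiag q).1 (hdiag q).2)

theorem id_mem_channels : LinearMap.id ∈ channels :=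
  ⟨fun _ _ hX => hX, fun _ => rfl⟩

theorem isGreatest_maxValue (τ : Op₂) :
    IsGreatest (choiValues τ channels) (maxValue τ channels) := by
  have h : choiValues τ channels = (fun J => (τ * J).trace.re) '' (choi '' channels) := by
    rw [Set.image_image]
    rfl
  refine IsCompact.isGreatest_sSup ?_ (Set.Nonempty.image _ ⟨_, id_mem_channels⟩)
  rw [h]
  exact isCompact_image_choi_channels.image (by fun_prop)

/-! ### Action of a channel on the Bloch ball -/

theorem bloch_eq (A : Op) :
    bloch A = !₂[(A 0 1).re + (A 1 0).re, (A 1 0).im - (A 0 1).im, (A 0 0).re - (A 1 1).re] := by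
  ext i
  fin_cases i <;> simp [bloch, pauli, trace_fin_two, Matrix.mul_apply, Fin.sum_univ_two] <;> ring

theorem IsHermitian.eq_trace_add_sum_pauli {A : Op} (hA : A.IsHermitian) :
    A = ((A.trace.re / 2 : ℝ) : ℂ) • (1 : Op) + ∑ j, ((bloch A j / 2 : ℝ) : ℂ) • pauli j := by
  have h00 := congrArg Complex.im (hA.apply 0 0)
  have h11 := congrArg Complex.im (hA.apply 1 1)
  have h10 := hA.apply 1 0
  simp only [Complex.star_def, Complex.conj_im] at h00 h11
  ext i j
  fin_cases i <;> fin_cases j <;> apply Complex.ext <;>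
    simp [bloch_eq, pauli, Fin.sum_univ_three, trace_fin_two, ← h10, Matrix.add_apply] <;> linarith

/-- For Hermitian A, (tr A)² - |b|² = 4 det A. -/
theorem PosSemidef.norm_bloch_le {A : Op} (hA : A.PosSemidef) : ‖bloch A‖ ^ 2 ≤ A.trace.re ^ 2 := by
  have h := PosSemidef.normSq_apply_le hA 0 1
  have h10 := hA.1.apply 1 0
  rw [← Complex.normSq_eq_norm_sq, Complex.normSq_apply] at h
  simp only [bloch_eq, EuclideanSpace.real_norm_sq_eq, Fin.sum_univ_three, trace_fin_two, ← h10]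
  simp
  nlinarith

theorem bloch_add (A B : Op) : bloch (A + B) = bloch A + bloch B := by
  ext i
  simp [bloch, Matrix.mul_add]

theorem bloch_smul (c : ℝ) (A : Op) : bloch ((c : ℂ) • A) = c • bloch A := by
  ext i
  simp [bloch]

theorem trace_pauli_transpose (i : Fin 3) : ((pauli i)ᵀ).trace = 0 := by
  fin_cases i <;> simp [pauli, trace_fin_two]

theorem posSemidef_one_add_pauli_transpose {r : Fin 3 → ℝ} (hr : r ⬝ᵥ r = 1) :
    (1 + ∑ i, (r i : ℂ) • (pauli i)ᵀ).PosSemidef := by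
  set A : Op := 1 + ∑ i, (r i : ℂ) • (pauli i)ᵀ with hA
  have hr' : (r 0 : ℂ) * r 0 + r 1 * r 1 + r 2 * r 2 = 1 := by
    rw [dotProduct, Fin.sum_univ_three] at hr
    exact_mod_cast hr
  have hform : A = !![1 + (r 2 : ℂ), r 0 + r 1 * Complex.I; r 0 - r 1 * Complex.I, 1 - r 2] := by
    ext i j
    fin_cases i <;> fin_cases j <;>
      simp [hA, pauli, Fin.sum_univ_three, Matrix.add_apply] <;> ring
  -- A is twice a rank-one projection, the pure state at a point of the sphere.
  have hsq : Aᴴ * A = (2 : ℂ) • A := by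
    rw [hform]
    ext i j
    fin_cases i <;> fin_cases j <;>
      simp [Matrix.mul_apply, Fin.sum_univ_two] <;>
      first | ring1 | linear_combination (hr' - (r 1 : ℂ) ^ 2 * Complex.I_sq)
  have h : A = (1 / 2 : ℂ) • (Aᴴ * A) := by
    rw [hsq, smul_smul]
    norm_num
  rw [h]
  refine (posSemidef_conjTranspose_mul_self A).smul ?_
  norm_num [Complex.le_def]

theorem IsCompletelyPositive.posSemidef_map {Ψ : Op →ₗ[ℂ] Op} (hΨ : IsCompletelyPositive Ψ)
    {A : Op} (hA : A.PosSemidef) : (Ψ A).PosSemidef :=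
  (hΨ 1 _ (hA.submatrix Prod.snd)).submatrix fun b => (0, b)

/-- The Bloch vector of `Ψ(1)`, the translation part of the action of `Ψ` on the Bloch ball. -/
def shift (Ψ : Op →ₗ[ℂ] Op) : EuclideanSpace ℝ (Fin 3) := (1 / 2 : ℝ) • bloch (Ψ 1)

/-- The linear part of the action of `Ψ` on the Bloch ball. -/
def blochMatrix (Ψ : Op →ₗ[ℂ] Op) : Matrix (Fin 3) (Fin 3) ℝ :=
  of fun i j => bloch (Ψ (pauli i)ᵀ) j / 2

theorem norm_shift_add_le {Ψ : Op →ₗ[ℂ] Op} (hΨ : Ψ ∈ channels) {r : Fin 3 → ℝ}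
    (hr : r ⬝ᵥ r = 1) :
    ‖shift Ψ + WithLp.toLp 2 (r ᵥ* blochMatrix Ψ)‖ ^ 2 ≤ 1 := by
  have hpos := hΨ.1.posSemidef_map (posSemidef_one_add_pauli_transpose hr)
  have hb : shift Ψ + WithLp.toLp 2 (r ᵥ* blochMatrix Ψ) =
      (1 / 2 : ℝ) • bloch (Ψ (1 + ∑ i, (r i : ℂ) • (pauli i)ᵀ)) := by
    simp only [map_add, map_smul, Fin.sum_univ_three, bloch_add, bloch_smul]
    ext j
    simp [shift, blochMatrix, vecMul, dotProduct, Fin.sum_univ_three]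
    ring
  have htr : (Ψ (1 + ∑ i, (r i : ℂ) • (pauli i)ᵀ)).trace = 2 := by
    rw [hΨ.2]
    simp only [trace_add, trace_sum, trace_smul, trace_pauli_transpose]
    simp
  have h := PosSemidef.norm_bloch_le hpos
  rw [htr] at h
  rw [hb, norm_smul, mul_pow]
  norm_num at h ⊢
  linarith

/-- Averaging over the antipodal points r and -r cancels the cross term. -/
theorem norm_shift_sq_add_le {Ψ : Op →ₗ[ℂ] Op} (hΨ : Ψ ∈ channels) {r : Fin 3 → ℝ}
    (hr : r ⬝ᵥ r = 1) :
    ‖shift Ψ‖ ^ 2 + (r ᵥ* blochMatrix Ψ) ⬝ᵥ (r ᵥ* blochMatrix Ψ) ≤ 1 := by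
  have h1 := norm_shift_add_le hΨ hr
  have h2 := norm_shift_add_le hΨ (r := -r) (by simpa using hr)
  rw [neg_vecMul, WithLp.toLp_neg, ← sub_eq_add_neg] at h2
  have h3 := parallelogram_law_with_norm ℝ (shift Ψ) (WithLp.toLp 2 (r ᵥ* blochMatrix Ψ))
  have h4 : ‖WithLp.toLp 2 (r ᵥ* blochMatrix Ψ)‖ ^ 2 =
      (r ᵥ* blochMatrix Ψ) ⬝ᵥ (r ᵥ* blochMatrix Ψ) := by
    rw [EuclideanSpace.real_norm_sq_eq]
    simp [dotProduct, sq]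
  nlinarith

theorem isHermitian_map_pauli_transpose {Ψ : Op →ₗ[ℂ] Op} (hΨ : IsCompletelyPositive Ψ)
    (i : Fin 3) : (Ψ (pauli i)ᵀ).IsHermitian := by
  have h := (hΨ.posSemidef_map (posSemidef_one_add_pauli_transpose
    (r := Pi.single i 1) (by simp))).1.sub (hΨ.posSemidef_map PosSemidef.one).1
  convert h using 1
  fin_cases i <;> simp

/-- The transposes come from the Pauli expansion of the maximally entangled operator, and are why
`blochMatrix` uses them. -/
theorem choi_eq_sum_pauli (Ψ : Op →ₗ[ℂ] Op) :
    choi Ψ = (1 / 2 : ℂ) • (1 ⊗ₖ Ψ 1 + ∑ i, pauli i ⊗ₖ Ψ (pauli i)ᵀ) := by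
  have h : maxEntangled = (1 / 2 : ℂ) • ((1 : Op) ⊗ₖ (1 : Op) + ∑ i, pauli i ⊗ₖ (pauli i)ᵀ) := by
    rw [maxEntangled_eq]
    ext ⟨a, b⟩ ⟨a', b'⟩
    fin_cases a <;> fin_cases a' <;> fin_cases b <;> fin_cases b' <;>
      simp [pauli, Fin.sum_univ_three, Matrix.add_apply, vecMulVec_apply] <;> norm_num
  have hadd (X Y : Op₂) : idTensor Ψ (X + Y) = idTensor Ψ X + idTensor Ψ Y := by
    ext p q
    change Ψ (of (fun b b' => X (p.1, b) (q.1, b')) + of (fun b b' => Y (p.1, b) (q.1, b'))) _ _ = _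
    rw [map_add]
    rfl
  have hsmul (c : ℂ) (X : Op₂) : idTensor Ψ (c • X) = c • idTensor Ψ X := by
    ext p q
    change Ψ (c • of (fun b b' => X (p.1, b) (q.1, b'))) _ _ = _
    rw [map_smul]
    rfl
  rw [choi, h, hsmul]
  simp only [Fin.sum_univ_three, hadd, idTensor_kronecker]

theorem trace_mul_one_kronecker (τ : Op₂) (A : Op) :
    (τ * (1 ⊗ₖ A)).trace = (A * marginal₂ τ).trace := by
  simp [trace, mul_apply, Fintype.sum_prod_type, marginal₂, Matrix.one_apply, Fin.sum_univ_two]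
  ring

theorem trace_mul_choi {τ : Op₂} (hτ : τ.trace = 1) {Ψ : Op →ₗ[ℂ] Op} (hΨ : Ψ ∈ channels) :
    (τ * choi Ψ).trace.re = (1 / 2 : ℝ) * (1 + (inner ℝ (shift Ψ) (bloch (marginal₂ τ)) +
      ∑ i, ∑ j, blochMatrix Ψ i j * corrMatrix τ i j)) := by
  have h1 : Ψ 1 = 1 + ∑ j, (shift Ψ j : ℂ) • pauli j := by
    have h := IsHermitian.eq_trace_add_sum_pauli (hΨ.1.posSemidef_map PosSemidef.one).1
    rw [hΨ.2] at h
    conv_lhs => rw [h]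
    simp [shift, div_eq_inv_mul]
  have hp (i : Fin 3) : Ψ (pauli i)ᵀ = ∑ j, (blochMatrix Ψ i j : ℂ) • pauli j := by
    have h := IsHermitian.eq_trace_add_sum_pauli (isHermitian_map_pauli_transpose hΨ.1 i)
    rw [hΨ.2, trace_pauli_transpose] at h
    conv_lhs => rw [h]
    simp [blochMatrix]
  have ht : (marginal₂ τ).trace = 1 := by
    have h := trace_mul_one_kronecker τ 1
    rw [one_kronecker_one, Matrix.mul_one, Matrix.one_mul] at h
    rw [← h, hτ]
  rw [choi_eq_sum_pauli, Matrix.mul_smul, Matrix.mul_add, trace_smul, trace_add,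
    trace_mul_one_kronecker, h1]
  simp only [hp, Fin.sum_univ_three, kronecker_add, kronecker_smul, Matrix.mul_add,
    Matrix.mul_smul, trace_add, trace_smul, Matrix.add_mul, Matrix.one_mul, Matrix.smul_mul, ht]
  simp [PiLp.inner_apply, bloch, corrMatrix, Fin.sum_univ_three]
  ring

theorem trace_mul_choi_le {τ : Op₂} (hτ : IsDensity τ) {Ψ : Op →ₗ[ℂ] Op} (hΨ : Ψ ∈ channels) :
    (τ * choi Ψ).trace.re ≤ (1 / 2 : ℝ) *
      (1 + √(‖bloch (marginal₂ τ)‖ ^ 2 + kyFanNorm (corrMatrix τ) ^ 2)) := by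
  have hs : 0 ≤ 1 - ‖shift Ψ‖ ^ 2 := by
    -- Any unit vector would do here.
    have h := norm_shift_sq_add_le hΨ (r := Pi.single 0 1) (by simp)
    have h' := dotProduct_self_star_nonneg (Pi.single 0 1 ᵥ* blochMatrix Ψ)
    rw [star_trivial] at h'
    linarith
  have hM := sum_mul_le_mul_trace_sqrt (blochMatrix Ψ) (corrMatrix τ)
    (c := √(1 - ‖shift Ψ‖ ^ 2)) (fun u hu => by
      rw [Real.sq_sqrt hs]
      linarith [norm_shift_sq_add_le hΨ hu]) (Real.sqrt_nonneg _)
  have hi := real_inner_le_norm (shift Ψ) (bloch (marginal₂ τ))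
  rw [trace_mul_choi hτ.2 hΨ]
  gcongr
  refine (add_le_add hi hM).trans (Real.le_sqrt_of_sq_le ?_)
  rw [← kyFanNorm]
  have hc := Real.sq_sqrt hs
  -- The square is the Lagrange defect in Cauchy–Schwarz for (|t|, √(1 - |t|²)), a unit vector, and
  -- (|b|, ‖N‖_KF).
  nlinarith [sq_nonneg (‖shift Ψ‖ * kyFanNorm (corrMatrix τ) -
    √(1 - ‖shift Ψ‖ ^ 2) * ‖bloch (marginal₂ τ)‖)]

end QubitChannel

end

theorem mainTheorem2 (τ : QubitChannel.Op₂) (hτ : QubitChannel.IsDensity τ) :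
    IsGreatest (QubitChannel.choiValues τ QubitChannel.channels)
        (QubitChannel.maxValue τ QubitChannel.channels) ∧
      QubitChannel.maxValue τ QubitChannel.channels ≤
        (1 / 2 : ℝ) *
          (1 + Real.sqrt (‖QubitChannel.bloch (QubitChannel.marginal₂ τ)‖ ^ 2 +
            QubitChannel.kyFanNorm (QubitChannel.corrMatrix τ) ^ 2)) :=
  ⟨QubitChannel.isGreatest_maxValue τ, by
    obtain ⟨Ψ, hΨ, h⟩ := (QubitChannel.isGreatest_maxValue τ).1
    rw [← h]
    exact QubitChannel.trace_mul_choi_le hτ hΨ⟩
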